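/- Let $\langle x\rangle$ denote the fractional part of $x$ and $\langle x\rangle^*:=1-\langle 1-x\rangle$. For a set $A\subset\mathbb R$ write $1-A=\{1-t:t\in A\}$. Let $0\le\alpha<1$ and $0\le x_1<x_2\le 1$. Define $\mathcal M:[0,1)\to[0,1)$ by $$\mathcal M(t)=\begin{cases}\langle t+\alpha+x_2-x_1\rangle, & t\in[0,x_1),\\ t, & t\in[x_1,x_2),\\ \langle t+\alpha\rangle, & t\in[x_2,1),\end{cases}$$ and $\widetilde{\mathcal M}:(0,1]\to(0,1]$ by $$\widetilde{\mathcal M}(t)=\begin{cases}\langle t+\alpha+x_2-x_1\rangle^*, & t\in(0,x_1],\\ t, & t\in(x_1,x_2],\\ \langle t+\alpha\rangle^*, & t\in(x_2,1].\end{cases}$$ Let $\mathcal S$ be the largest set with $\mathcal S\subset[0,1)\setminus[x_1,x_2)$ and $\mathcal M(\mathcal S)=\mathcal S$. Let $\mathcal E$ be the largest set with $\mathcal E\subset[0,1)\setminus\big([x_1,x_2)\cup(1-(x_1,x_2])\big)$, $\mathcal M(\mathcal E)=\mathcal E$ and $\widetilde{\mathcal M}(1-\mathcal E)=1-\mathcal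 E$. For a finite union $A=\bigcup_k[c_k,d_k)$ of intervals in $[0,1)$, let $\pi(A)=\bigcup_k(c_k,d_k]$, which does not depend on the decomposition. If $\mathcal E\neq\emptyset$, then $\mathcal S$ is a finite union of left-closed, right-open intervals (so that $\pi(\mathcal S)$ is defined), $$\mathcal E=\mathcal S\cap(1-\pi(\mathcal S)),$$ and for every $t\in\mathcal E$, $$\mathcal M\big(1-\widetilde{\mathcal M}(1-t)\big)=1-\widetilde{\mathcal M}\big(1-\mathcal M(t)\big)=t.$$ -/

import Mathlib

namespace PiecewiseLinear

/-- The piecewise linear transformation `M = M_{α, x₁, x₂}` of the unit circle, represented by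
`[0, 1)`: with `U = [0, x₁)`, `H = [x₁, x₂)`, `V = [x₂, 1)`, it is `t ↦ ⟨t + α + x₂ - x₁⟩` on `U`,
the identity on `H` and `t ↦ ⟨t + α⟩` on `V`, where `⟨x⟩` is the fractional part.
(Only its values on `[0, 1)` are ever used.) -/
noncomputable def map (α x₁ x₂ t : ℝ) : ℝ :=
  if t < x₁ then Int.fract (t + α + x₂ - x₁)
  else if t < x₂ then t
  else Int.fract (t + α)

/-- `⟨x⟩* = 1 - ⟨1 - x⟩`, the representative of `x` modulo 1 in `(0, 1]`. -/
noncomputable def fractStar (x : ℝ) : ℝ := 1 - Int.fract (1 - x)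

/-- The coherent map `M̃` of `M`, on the unit circle represented by `(0, 1]`: it is
`t ↦ ⟨t + α + x₂ - x₁⟩*` on `(0, x₁]`, the identity on `(x₁, x₂]` and `t ↦ ⟨t + α⟩*` on `(x₂, 1]`.
(Only its values on `(0, 1]` are ever used.) -/
noncomputable def coherentMap (α x₁ x₂ t : ℝ) : ℝ :=
  if t ≤ x₁ then fractStar (t + α + x₂ - x₁)
  else if t ≤ x₂ then t
  else fractStar (t + α)

/-- The reflection `1 - A = {1 - t : t ∈ A}`. -/
def reflect (A : Set ℝ) : Set ℝ := (fun t => 1 - t) '' A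

/-- `A ⊆ [0, 1) \ H` and `M(A) = A`. -/
def IsInvariant (α x₁ x₂ : ℝ) (A : Set ℝ) : Prop :=
  A ⊆ Set.Ico 0 1 \ Set.Ico x₁ x₂ ∧ map α x₁ x₂ '' A = A

/-- `A ⊆ [0, 1) \ (H ∪ (1 - H̃))`, `M(A) = A` and `M̃(1 - A) = 1 - A`. -/
def IsSymmInvariant (α x₁ x₂ : ℝ) (A : Set ℝ) : Prop :=
  A ⊆ Set.Ico 0 1 \ (Set.Ico x₁ x₂ ∪ reflect (Set.Ioc x₁ x₂)) ∧
    map α x₁ x₂ '' A = A ∧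
    coherentMap α x₁ x₂ '' reflect A = reflect A

/-- The maximal invariant set `S` of `M`: the largest set satisfying `IsInvariant`. -/
def maxInvariant (α x₁ x₂ : ℝ) : Set ℝ := ⋃₀ {A | IsInvariant α x₁ x₂ A}

/-- The symmetric maximal invariant set `E` of `M`: the largest set satisfying
`IsSymmInvariant`. -/
def symmMaxInvariant (α x₁ x₂ : ℝ) : Set ℝ := ⋃₀ {A | IsSymmInvariant α x₁ x₂ A}

theorem isGreatest_maxInvariant (α x₁ x₂ : ℝ) :
    IsGreatest {A | IsInvariant α x₁ x₂ A} (maxInvariant α x₁ x₂) := by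
  refine ⟨⟨Set.sUnion_subset fun A hA => hA.1, ?_⟩, fun A hA => Set.subset_sUnion_of_mem hA⟩
  rw [maxInvariant, Set.sUnion_eq_biUnion, Set.image_iUnion₂]
  exact Set.iUnion₂_congr fun A hA => hA.2

theorem isGreatest_symmMaxInvariant (α x₁ x₂ : ℝ) :
    IsGreatest {A | IsSymmInvariant α x₁ x₂ A} (symmMaxInvariant α x₁ x₂) := by
  refine ⟨⟨Set.sUnion_subset fun A hA => hA.1, ?_, ?_⟩,
    fun A hA => Set.subset_sUnion_of_mem hA⟩
  · rw [symmMaxInvariant, Set.sUnion_eq_biUnion, Set.image_iUnion₂]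
    exact Set.iUnion₂_congr fun A hA => hA.2.1
  · rw [symmMaxInvariant, Set.sUnion_eq_biUnion, reflect, Set.image_iUnion₂, Set.image_iUnion₂]
    exact Set.iUnion₂_congr fun A hA => hA.2.2

/-- `A` is the union of the intervals `[c, d)` with `(c, d)` in the finite set `s`, all of which
are contained in `[0, 1)`. -/
def IsIcoUnion (s : Finset (ℝ × ℝ)) (A : Set ℝ) : Prop :=
  (∀ p ∈ s, 0 ≤ p.1 ∧ p.1 < p.2 ∧ p.2 ≤ 1) ∧ A = ⋃ p ∈ s, Set.Ico p.1 p.2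

/-- The endpoint exchange `π`: the union of all `(c, d]` with `c < d` and `[c, d) ⊆ A`. On a finite
union of intervals `[c, d)` it is the union of the corresponding `(c, d]`, whatever the
decomposition: see `endpointExchange_eq`. -/
def endpointExchange (A : Set ℝ) : Set ℝ :=
  {t | ∃ c d : ℝ, c < d ∧ Set.Ico c d ⊆ A ∧ t ∈ Set.Ioc c d}

theorem endpointExchange_eq {s : Finset (ℝ × ℝ)} {A : Set ℝ} (h : IsIcoUnion s A) :
    endpointExchange A = ⋃ p ∈ s, Set.Ioc p.1 p.2 := by
  obtain ⟨h1, rfl⟩ := h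
  ext t
  simp only [endpointExchange, Set.mem_setOf_eq, Set.mem_iUnion, exists_prop]
  constructor
  · rintro ⟨c, d, -, hA, hct, htd⟩
    by_contra! hno
    -- every interval of the family misses a left neighbourhood of `t`
    have key : ∀ᶠ u in nhdsWithin t (Set.Iio t), ∀ p ∈ s, u ∉ Set.Ico p.1 p.2 := by
      rw [Filter.eventually_all_finset]
      intro p hp
      rcases le_or_gt t p.1 with h | h
      · filter_upwards [self_mem_nhdsWithin] with u hu hup
        exact absurd (lt_of_lt_of_le hu h) (not_lt.2 hup.1)
      · have h2 : p.2 < t := by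
          by_contra! h3
          exact hno p hp ⟨h, h3⟩
        filter_upwards [Ioo_mem_nhdsLT h2] with u hu hup
        exact absurd hup.2 (not_lt.2 hu.1.le)
    obtain ⟨u, hu1, hu2⟩ := (key.and (Ioo_mem_nhdsLT hct)).exists
    have := hA ⟨hu2.1.le, hu2.2.trans_le htd⟩
    simp only [Set.mem_iUnion, exists_prop] at this
    obtain ⟨p, hp, hup⟩ := this
    exact hu1 p hp hup
  · rintro ⟨p, hp, ht⟩
    exact ⟨p.1, p.2, (h1 p hp).2.1, fun u hu => Set.mem_biUnion hp hu, ht⟩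

end PiecewiseLinear

namespace PiecewiseLinear

/-! Write δ = x₂ - x₁ and N(t) = 1 - M̃(1 - t). Modulo 1, N translates by -α below 1 - H̃ and by -(α
+ δ) above it, so on E the composite M ∘ N is the identity or a shift by ±δ. A genuine shift would
repeat forever inside the bounded set E; hence N is a right inverse of M there, and it exchanges the
two sides of the gaps (`le_one_sub_coherentMap`, `one_sub_coherentMap_lt`).

If E lies on one side of H, then M acts on it as a rotation of the unit circle. If E meets both
sides, only points above H wrap around (`wrap_of_mem_symmMaxInvariant`), and M acts as the rotation
by α + δ of a circle of length 1 + δ, got by inserting the arc [1, 1 + δ). In every case E avoids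
some [a, b) ⊇ H, off which M is a rotation by ρ of a circle of length ℓ (`IsRotationOff`), and also
avoids [1 - b, 1 - a).

Rotation orbits that avoid an interval force ρ and ℓ to be integer multiples of some P > 0 in ρℤ +
ℓℤ (`exists_common_divisor`). A point of S in [a, b) would drift by σ ≠ 0 at each return, so S
avoids [a, b) as well (`maxInvariant_notMem`), and S is what remains of [0, 1) after removing [a, b)
+ Pℤ (`maxInvariant_eq`). Removing the reflected translates too leaves a set on which M and N are
opposite rotations, and this set is E. -/

/-- Two points of a fundamental domain `[0, ℓ)` that are congruent modulo `ℓ` coincide. -/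
theorem eq_of_mem_Ico_of_eq_add {ℓ x y : ℝ} (k : ℤ) (hx : x ∈ Set.Ico 0 ℓ) (hy : y ∈ Set.Ico 0 ℓ)
    (h : y = x + k * ℓ) : y = x := by
  have hℓ : 0 < ℓ := hx.1.trans_lt hx.2
  have h1 : (-1 : ℝ) < k := by
    by_contra! hk
    nlinarith [hx.2, hy.1]
  have h2 : (k : ℝ) < 1 := by
    by_contra! hk
    nlinarith [hx.1, hy.2]
  have h3 : -1 < k := by exact_mod_cast h1
  have h4 : k < 1 := by exact_mod_cast h2
  obtain rfl : k = 0 := by omega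
  simpa using h

theorem map_mem_Ico (α x₁ x₂ : ℝ) {t : ℝ} (ht : t ∈ Set.Ico (0 : ℝ) 1) :
    map α x₁ x₂ t ∈ Set.Ico (0 : ℝ) 1 := by
  unfold map
  split_ifs
  · exact ⟨Int.fract_nonneg _, Int.fract_lt_one _⟩
  · exact ht
  · exact ⟨Int.fract_nonneg _, Int.fract_lt_one _⟩

theorem fractStar_mem_Ioc (x : ℝ) : fractStar x ∈ Set.Ioc (0 : ℝ) 1 := by
  unfold fractStar
  exact ⟨by linarith [Int.fract_lt_one (1 - x)], by linarith [Int.fract_nonneg (1 - x)]⟩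

theorem coherentMap_mem_Ioc (α x₁ x₂ : ℝ) {t : ℝ} (ht : t ∈ Set.Ioc (0 : ℝ) 1) :
    coherentMap α x₁ x₂ t ∈ Set.Ioc (0 : ℝ) 1 := by
  unfold coherentMap
  split_ifs
  · exact fractStar_mem_Ioc _
  · exact ht
  · exact fractStar_mem_Ioc _

theorem fract_eq_add_int (x : ℝ) : ∃ k : ℤ, Int.fract x = x + k :=
  ⟨-⌊x⌋, by rw [Int.fract]; push_cast; ring⟩

theorem fractStar_eq_add_int (x : ℝ) : ∃ k : ℤ, fractStar x = x + k := by
  obtain ⟨k, hk⟩ := fract_eq_add_int (1 - x)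
  exact ⟨-k, by rw [fractStar, hk]; push_cast; ring⟩

theorem one_sub_coherentMap_mem_Ico (α x₁ x₂ : ℝ) {t : ℝ} (ht : t ∈ Set.Ico (0 : ℝ) 1) :
    1 - coherentMap α x₁ x₂ (1 - t) ∈ Set.Ico (0 : ℝ) 1 := by
  have := coherentMap_mem_Ioc α x₁ x₂ (t := 1 - t) ⟨by linarith [ht.2], by linarith [ht.1]⟩
  exact ⟨by linarith [this.2], by linarith [this.1]⟩

theorem mem_reflect {A : Set ℝ} {t : ℝ} : t ∈ reflect A ↔ 1 - t ∈ A := by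
  constructor
  · rintro ⟨s, hs, rfl⟩
    simpa using hs
  · exact fun h => ⟨1 - t, h, by simp⟩

theorem mem_endpointExchange {A : Set ℝ} {t : ℝ} :
    t ∈ endpointExchange A ↔ ∃ c < t, Set.Ico c t ⊆ A := by
  constructor
  · rintro ⟨c, d, -, hA, hct, htd⟩
    exact ⟨c, hct, fun u hu => hA ⟨hu.1, hu.2.trans_le htd⟩⟩
  · rintro ⟨c, hct, hA⟩
    exact ⟨c, t, hct, hA, hct, le_rfl⟩

/-! ### Complements of periodic unions of intervals, and commensurability. -/

section Periodic

variable {P a b : ℝ}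

/-- The complement of the `P`-periodic union of the intervals `[a, b) + P ℤ`. -/
theorem forall_add_notMem_Ico_iff (hP : 0 < P) {x : ℝ} :
    (∀ k : ℤ, x + k * P ∉ Set.Ico a b) ↔
      ∃ k : ℤ, x ∈ Set.Ico (b + k * P) (a + (k + 1) * P) := by
  constructor
  · intro h
    -- The floor selects the last right endpoint b + kP at or below x.
    have h1 := Int.floor_le ((x - b) / P)
    have h2 := Int.lt_floor_add_one ((x - b) / P)
    set k := ⌊(x - b) / P⌋
    rw [le_div_iff₀ hP] at h1
    rw [div_lt_iff₀ hP] at h2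
    refine ⟨k, by linarith, ?_⟩
    by_contra! h3
    exact h (-(k + 1)) ⟨by push_cast; linarith, by push_cast; linarith⟩
  · rintro ⟨k, hk1, hk2⟩ j ⟨hj1, hj2⟩
    have h1 : (0 : ℝ) < (k + 1 + j : ℤ) := by
      push_cast
      by_contra! h
      nlinarith
    have h2 : ((k + j : ℤ) : ℝ) < 0 := by
      push_cast
      by_contra! h
      nlinarith
    have h3 : 0 < k + 1 + j := by exact_mod_cast h1
    have h4 : k + j < 0 := by exact_mod_cast h2
    omega

theorem forall_add_notMem_Ioc_iff (hP : 0 < P) {x : ℝ} :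
    (∀ k : ℤ, x + k * P ∉ Set.Ioc a b) ↔
      ∃ k : ℤ, x ∈ Set.Ioc (b + k * P) (a + (k + 1) * P) := by
  -- The reflection x ↦ -x exchanges the two kinds of half-open intervals.
  have key := forall_add_notMem_Ico_iff hP (a := -b) (b := -a) (x := -x)
  constructor
  · intro h
    obtain ⟨k, hk⟩ := key.1 fun k hk => h (-k) ⟨by push_cast; linarith [hk.2],
      by push_cast; linarith [hk.1]⟩
    exact ⟨-(k + 1), by push_cast; linarith [hk.2], by push_cast; linarith [hk.1]⟩
  · rintro ⟨k, hk⟩ j hj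
    exact key.2 ⟨-(k + 1), by push_cast; linarith [hk.2], by push_cast; linarith [hk.1]⟩ (-j)
      ⟨by push_cast; linarith [hj.2], by push_cast; linarith [hj.1]⟩

/-- The part of `[0, 1)` outside of `[a, b) + P ℤ`. -/
def periodicCompl (P a b : ℝ) : Set ℝ :=
  {x | x ∈ Set.Ico (0 : ℝ) 1 ∧ ∀ k : ℤ, x + k * P ∉ Set.Ico a b}

theorem exists_isIcoUnion_periodicCompl (hP : 0 < P) :
    ∃ s : Finset (ℝ × ℝ), IsIcoUnion s (periodicCompl P a b) := by
  classical
  -- This n bounds |k| for every gap [b + kP, a + (k + 1)P) that meets [0, 1).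
  obtain ⟨n, hn⟩ := exists_int_gt ((1 + |a| + |b|) / P + 1)
  rw [← lt_sub_iff_add_lt, div_lt_iff₀ hP] at hn
  refine ⟨((Finset.Icc (-n) n).image fun k : ℤ =>
    (max 0 (b + k * P), min 1 (a + (k + 1) * P))).filter fun p => p.1 < p.2, ?_, ?_⟩
  · intro p hp
    obtain ⟨hp, hlt⟩ := Finset.mem_filter.1 hp
    obtain ⟨k, -, rfl⟩ := Finset.mem_image.1 hp
    exact ⟨le_max_left _ _, hlt, min_le_left _ _⟩
  · ext x
    simp only [periodicCompl, Set.mem_ofPred_eq, forall_add_notMem_Ico_iff hP, Set.mem_iUnion,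
      exists_prop, Finset.mem_filter, Finset.mem_image, Finset.mem_Icc]
    constructor
    · rintro ⟨⟨h0, h1⟩, k, hk1, hk2⟩
      have hmem : x ∈ Set.Ico (max 0 (b + k * P)) (min 1 (a + (k + 1) * P)) :=
        ⟨max_le h0 hk1, lt_min h1 hk2⟩
      refine ⟨_, ⟨⟨k, ⟨?_, ?_⟩, rfl⟩, hmem.1.trans_lt hmem.2⟩, hmem⟩
      · by_contra! h
        have h' : (k : ℝ) + 1 ≤ -n := by exact_mod_cast h
        nlinarith [le_abs_self a, abs_nonneg b]
      · by_contra! h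
        have h' : (n : ℝ) + 1 ≤ k := by exact_mod_cast h
        nlinarith [neg_abs_le b, abs_nonneg a]
    · rintro ⟨_, ⟨⟨k, -, rfl⟩, -⟩, hx1, hx2⟩
      exact ⟨⟨(le_max_left _ _).trans hx1, hx2.trans_le (min_le_left _ _)⟩, k,
        (le_max_right _ _).trans hx1, hx2.trans_le (min_le_right _ _)⟩

/-- A point has a left neighbourhood missing every [a, b) + kP exactly when it lies in no (a, b] +
kP, so π only moves the endpoints of the removed intervals. -/
theorem mem_endpointExchange_periodicCompl (hP : 0 < P) {t : ℝ} :
    t ∈ endpointExchange (periodicCompl P a b) ↔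
      t ∈ Set.Ioc (0 : ℝ) 1 ∧ ∀ k : ℤ, t + k * P ∉ Set.Ioc a b := by
  rw [mem_endpointExchange]
  constructor
  · rintro ⟨c, hc, h⟩
    refine ⟨⟨(h ⟨le_rfl, hc⟩).1.1.trans_lt hc, ?_⟩, fun k hk => ?_⟩
    · by_contra! h1
      obtain ⟨u, hu1, hu2⟩ := exists_between (max_lt hc h1)
      have := (h (show u ∈ Set.Ico c t from ⟨(le_max_left _ _).trans hu1.le, hu2⟩)).1.2
      linarith [le_max_right c 1]
    · obtain ⟨u, hu1, hu2⟩ := exists_between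
        (max_lt hc (show a - k * P < t by linarith [hk.1]))
      exact (h (show u ∈ Set.Ico c t from ⟨(le_max_left _ _).trans hu1.le, hu2⟩)).2 k
        ⟨by linarith [le_max_right c (a - k * P)], by linarith [hk.2]⟩
  · rintro ⟨⟨h0, h1⟩, h⟩
    obtain ⟨k, hk1, hk2⟩ := (forall_add_notMem_Ioc_iff hP).1 h
    refine ⟨max 0 (b + k * P), max_lt h0 hk1, fun u hu => ⟨⟨(le_max_left _ _).trans hu.1,
      hu.2.trans_le h1⟩, (forall_add_notMem_Ico_iff hP).2 ⟨k, (le_max_right _ _).trans hu.1,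
      hu.2.trans_le hk2⟩⟩⟩

/-- A point of `ℝ` whose orbit under the translations by `ρ` and `ℓ` avoids an interval forces
`ρ` and `ℓ` to be commensurable. -/
theorem exists_common_divisor {ρ ℓ e : ℝ} (hℓ : 0 < ℓ) (hab : a < b)
    (he : ∀ i j : ℤ, e + i * ρ + j * ℓ ∉ Set.Ico a b) :
    ∃ P > 0, (∃ i j : ℤ, P = i * ρ + j * ℓ) ∧ (∃ m : ℤ, ρ = m * P) ∧ ∃ n : ℤ, ℓ = n * P := by
  -- A dense group would carry e into [a, b); otherwise a generator serves as P, nonzero because ℓ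
  -- is.
  rcases (AddSubgroup.closure {ρ, ℓ}).dense_or_cyclic with hd | ⟨P, hP⟩
  · exfalso
    obtain ⟨g, hg, hg1, hg2⟩ := hd.exists_between (sub_lt_sub_right hab e)
    obtain ⟨i, j, rfl⟩ := AddSubgroup.mem_closure_pair.1 hg
    simp only [zsmul_eq_mul] at hg1 hg2
    exact he i j ⟨by linarith, by linarith⟩
  · have key : ∃ P > 0, AddSubgroup.closure {ρ, ℓ} = AddSubgroup.closure {P} := by
      refine ⟨|P|, abs_pos.2 ?_, ?_⟩
      · rintro rfl
        have : ℓ ∈ AddSubgroup.closure {(0 : ℝ)} := hP ▸ AddSubgroup.subset_closure (by simp)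
        obtain ⟨n, hn⟩ := AddSubgroup.mem_closure_singleton.1 this
        simp at hn
        exact hℓ.ne hn
      · rw [hP, ← AddSubgroup.zmultiples_eq_closure, ← AddSubgroup.zmultiples_eq_closure]
        rcases abs_choice P with h | h <;> rw [h]
        simp
    obtain ⟨P, hP0, hP⟩ := key
    refine ⟨P, hP0, ?_, ?_, ?_⟩
    · have : P ∈ AddSubgroup.closure {ρ, ℓ} := hP ▸ AddSubgroup.subset_closure (by simp)
      obtain ⟨i, j, h⟩ := AddSubgroup.mem_closure_pair.1 this
      exact ⟨i, j, by simpa using h.symm⟩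
    · have : ρ ∈ AddSubgroup.closure {P} := hP ▸ AddSubgroup.subset_closure (by simp)
      obtain ⟨n, hn⟩ := AddSubgroup.mem_closure_singleton.1 this
      exact ⟨n, by simpa using hn.symm⟩
    · have : ℓ ∈ AddSubgroup.closure {P} := hP ▸ AddSubgroup.subset_closure (by simp)
      obtain ⟨n, hn⟩ := AddSubgroup.mem_closure_singleton.1 this
      exact ⟨n, by simpa using hn.symm⟩

end Periodic
end PiecewiseLinear

/-! ### Dynamics of a map that is a rotation off an interval. -/

namespace PiecewiseLinear

/-- Off the interval `[a, b) ⊇ [x₁, x₂)` the map `M` is the rotation by `ρ` of a circle of length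
`ℓ ≥ 1`, and on `[a, b) \ [x₁, x₂)` it is this rotation preceded by a fixed shift by `σ`, which
does not leave `[a, b)`. -/
structure IsRotationOff (α x₁ x₂ ρ ℓ a b σ : ℝ) : Prop where
  one_le : 1 ≤ ℓ
  shift_ne_zero : σ ≠ 0
  nonneg : 0 ≤ a
  le_one : b ≤ 1
  lt : a < b
  Ico_subset : Set.Ico x₁ x₂ ⊆ Set.Ico a b
  Ioc_subset : Set.Ioc x₁ x₂ ⊆ Set.Ioc a b
  map_off : ∀ x ∈ Set.Ico (0 : ℝ) 1, x ∉ Set.Ico a b → ∃ k : ℤ, map α x₁ x₂ x = x + ρ + k * ℓ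
  shift_mem : ∀ x ∈ Set.Ico a b, x ∉ Set.Ico x₁ x₂ → x + σ ∈ Set.Ico a b
  map_on : ∀ x ∈ Set.Ico a b, x ∉ Set.Ico x₁ x₂ → ∃ k : ℤ, map α x₁ x₂ x = x + σ + ρ + k * ℓ
  coherentMap_off : ∀ t ∈ Set.Ioc (0 : ℝ) 1, t ∉ Set.Ioc a b →
    ∃ k : ℤ, coherentMap α x₁ x₂ t = t + ρ + k * ℓ
  cover : ∀ x, 1 ≤ x → x < ℓ → ∃ i j : ℤ, x + i * ρ + j * ℓ ∈ Set.Ico a b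

namespace IsRotationOff

variable {α x₁ x₂ ρ ℓ a b σ : ℝ}

theorem Ico_subset_Ico (h : IsRotationOff α x₁ x₂ ρ ℓ a b σ) :
    Set.Ico (0 : ℝ) 1 ⊆ Set.Ico 0 ℓ :=
  Set.Ico_subset_Ico_right h.one_le

/-- An `M`-invariant set outside of `[a, b)` is invariant under the rotation. -/
theorem exists_mem_eq_add (h : IsRotationOff α x₁ x₂ ρ ℓ a b σ) {A : Set ℝ}
    (hA : A ⊆ Set.Ico 0 1) (hAK : ∀ x ∈ A, x ∉ Set.Ico a b) (hM : map α x₁ x₂ '' A = A)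
    {x : ℝ} (hx : x ∈ A) (i : ℤ) : ∃ y ∈ A, ∃ j : ℤ, y = x + i * ρ + j * ℓ := by
  induction i using Int.induction_on with
  | zero => exact ⟨x, hx, 0, by simp⟩
  | succ i ih =>
    obtain ⟨y, hy, j, hj⟩ := ih
    obtain ⟨k, hk⟩ := h.map_off y (hA hy) (hAK y hy)
    refine ⟨_, hM ▸ Set.mem_image_of_mem _ hy, j + k, ?_⟩
    rw [hk, hj]
    push_cast
    ring
  | pred i ih =>
    obtain ⟨y, hy, j, hj⟩ := ih
    rw [← hM] at hy
    obtain ⟨z, hz, rfl⟩ := hy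
    obtain ⟨k, hk⟩ := h.map_off z (hA hz) (hAK z hz)
    refine ⟨z, hz, j - k, ?_⟩
    push_cast at hj ⊢
    linarith

/-- The translate is congruent modulo ℓ to a point of A, and both would lie in [0, ℓ), so a
translate in T would itself be a point of A. -/
theorem add_notMem (h : IsRotationOff α x₁ x₂ ρ ℓ a b σ) {A T : Set ℝ}
    (hA : A ⊆ Set.Ico 0 1) (hAK : ∀ x ∈ A, x ∉ Set.Ico a b) (hM : map α x₁ x₂ '' A = A)
    (hT : T ⊆ Set.Ico 0 1) (hAT : ∀ x ∈ A, x ∉ T) {x : ℝ} (hx : x ∈ A) (i j : ℤ) :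
    x + i * ρ + j * ℓ ∉ T := by
  intro hxT
  obtain ⟨y, hy, k, hk⟩ := h.exists_mem_eq_add hA hAK hM hx i
  have := eq_of_mem_Ico_of_eq_add (j - k) (h.Ico_subset_Ico (hA hy)) (h.Ico_subset_Ico (hT hxT))
    (by rw [hk]; push_cast; ring)
  exact hAT y hy (this ▸ hxT)

theorem Ico_subset_unit (h : IsRotationOff α x₁ x₂ ρ ℓ a b σ) : Set.Ico a b ⊆ Set.Ico 0 1 :=
  Set.Ico_subset_Ico h.nonneg h.le_one

/-! ### The maximal invariant set in the commensurable case. -/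

section Period

variable {P : ℝ} {m n : ℤ}

/-- The first step from s is the shift by σ followed by the rotation; later steps are pure rotations
until the orbit returns to [a, b). The return point is congruent to s + σ modulo P, and [a, b) is
shorter than P, so it is s + σ. -/
theorem add_shift_mem (h : IsRotationOff α x₁ x₂ ρ ℓ a b σ) (hP : 0 < P) (hρ : ρ = m * P)
    (hℓ : ℓ = n * P) {e : ℝ} (he : ∀ k : ℤ, e + k * P ∉ Set.Ico a b) {s : ℝ}
    (hs : s ∈ maxInvariant α x₁ x₂) (hsK : s ∈ Set.Ico a b) :
    s + σ ∈ maxInvariant α x₁ x₂ ∧ s + σ ∈ Set.Ico a b := by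
  obtain ⟨⟨hS, hM⟩, -⟩ := isGreatest_maxInvariant α x₁ x₂
  set S := maxInvariant α x₁ x₂
  set M := map α x₁ x₂
  have hmaps : ∀ x ∈ S, M x ∈ S := fun x hx => hM ▸ Set.mem_image_of_mem _ hx
  have hσ := h.shift_mem s hsK (hS hs).2
  obtain ⟨k₀, hk₀⟩ := h.map_on s hsK (hS hs).2
  have horb : ∀ j, M^[j] (M s) ∈ S := fun j => by
    induction j with
    | zero => exact hmaps s hs
    | succ j ih => rw [Function.iterate_succ_apply']; exact hmaps _ ih
  have hform : ∀ j : ℕ, (∀ i < j, M^[i] (M s) ∉ Set.Ico a b) →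
      ∃ k : ℤ, M^[j] (M s) = s + σ + (j + 1) * ρ + k * ℓ := by
    intro j
    induction j with
    | zero => exact fun _ => ⟨k₀, by simpa using hk₀⟩
    | succ j ih =>
      intro hj
      obtain ⟨k, hk⟩ := ih fun i hi => hj i (by omega)
      obtain ⟨k', hk'⟩ := h.map_off _ (hS (horb j)).1 (hj j (by omega))
      refine ⟨k + k', ?_⟩
      rw [Function.iterate_succ_apply']
      refine hk'.trans ?_
      rw [hk]
      push_cast
      ring
  have hn : 0 < n := by
    have : (0 : ℝ) < n := pos_of_mul_pos_left (hℓ ▸ zero_lt_one.trans_le h.one_le) hP.le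
    exact_mod_cast this
  -- After n rotations the total displacement nρ = mℓ is trivial on the circle. One rotation is
  -- already contained in M s, hence N = n - 1 further iterations.
  have hret : ∃ j, M^[j] (M s) ∈ Set.Ico a b := by
    by_contra! hno
    obtain ⟨N, hN⟩ : ∃ N : ℕ, (N : ℤ) + 1 = n := ⟨(n - 1).toNat, by omega⟩
    obtain ⟨k, hk⟩ := hform N fun i _ => hno i
    have hN' : (N : ℝ) + 1 = n := by exact_mod_cast hN
    refine hno N ?_
    rw [eq_of_mem_Ico_of_eq_add (m + k) (h.Ico_subset_Ico (h.Ico_subset_unit hσ))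
      (h.Ico_subset_Ico (hS (horb N)).1) (by rw [hk, hN', hρ, hℓ]; push_cast; ring)]
    exact hσ
  classical
  obtain ⟨k, hk⟩ := hform (Nat.find hret) fun i hi => Nat.find_min hret hi
  have hmem := Nat.find_spec hret
  set j := Nat.find hret
  -- The point e lies in a gap between consecutive translates, so those gaps are nonempty.
  have hlt : b - a < P := by
    obtain ⟨i, hi⟩ := (forall_add_notMem_Ico_iff hP).1 he
    linarith [hi.1.trans_lt hi.2]
  -- two points of `[a, b)` that are congruent modulo `P` coincide
  have heq := eq_of_mem_Ico_of_eq_add (ℓ := P) (x := s + σ - a) (y := M^[j] (M s) - a)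
    ((j + 1) * m + k * n) ⟨by linarith [hσ.1], by linarith [hσ.2]⟩
    ⟨by linarith [hmem.1], by linarith [hmem.2]⟩ (by rw [hk, hρ, hℓ]; push_cast; ring)
  have heq' : M^[j] (M s) = s + σ := by linarith
  exact ⟨heq' ▸ horb j, hσ⟩

/-- Repeated returns would put s + Nσ in [a, b) for all N, which is impossible as σ ≠ 0. -/
theorem maxInvariant_notMem (h : IsRotationOff α x₁ x₂ ρ ℓ a b σ) (hP : 0 < P) (hρ : ρ = m * P)
    (hℓ : ℓ = n * P) {e : ℝ} (he : ∀ k : ℤ, e + k * P ∉ Set.Ico a b) :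
    ∀ s ∈ maxInvariant α x₁ x₂, s ∉ Set.Ico a b := by
  intro s hs hsK
  have key : ∀ N : ℕ, s + N * σ ∈ maxInvariant α x₁ x₂ ∧ s + N * σ ∈ Set.Ico a b := fun N => by
    induction N with
    | zero => simpa using ⟨hs, hsK⟩
    | succ N ih =>
      have := h.add_shift_mem hP hρ hℓ he ih.1 ih.2
      push_cast
      rwa [add_one_mul, ← add_assoc]
  obtain ⟨N, hN⟩ := exists_nat_gt (1 / |σ|)
  rw [div_lt_iff₀ (abs_pos.2 h.shift_ne_zero), ← Nat.abs_cast, ← abs_mul] at hN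
  have h1 := h.Ico_subset_unit (key N).2
  have h0 := h.Ico_subset_unit hsK
  refine absurd hN (not_lt.2 (abs_le.2 ⟨?_, ?_⟩)) <;> linarith [h1.1, h1.2, h0.1, h0.2]

theorem maxInvariant_eq (h : IsRotationOff α x₁ x₂ ρ ℓ a b σ) (hP : 0 < P) (hρ : ρ = m * P)
    (hℓ : ℓ = n * P) (hPmem : ∃ i j : ℤ, P = i * ρ + j * ℓ) {e : ℝ}
    (he : ∀ k : ℤ, e + k * P ∉ Set.Ico a b) :
    maxInvariant α x₁ x₂ = periodicCompl P a b := by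
  have hSK := h.maxInvariant_notMem hP hρ hℓ he
  obtain ⟨⟨hS, hM⟩, hmax⟩ := isGreatest_maxInvariant α x₁ x₂
  refine Set.Subset.antisymm (fun s hs => ⟨(hS hs).1, fun k => ?_⟩) (hmax ⟨?_, ?_⟩)
  · obtain ⟨i, j, hij⟩ := hPmem
    have := h.add_notMem (fun x hx => (hS hx).1) hSK hM h.Ico_subset_unit hSK hs (k * i) (k * j)
    convert this using 2
    nth_rw 1 [hij]
    push_cast
    ring
  · exact fun x hx => ⟨hx.1, fun hxH => hx.2 0 (by simpa using h.Ico_subset hxH)⟩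
  · refine Set.Subset.antisymm ?_ fun y hy => ?_
    · rintro _ ⟨x, hx, rfl⟩
      refine ⟨map_mem_Ico _ _ _ hx.1, fun k hk => ?_⟩
      obtain ⟨i, hi⟩ := h.map_off x hx.1 (by simpa using hx.2 0)
      refine hx.2 (m + i * n + k) ?_
      convert hk using 1
      rw [hi, hρ, hℓ]
      push_cast
      ring
    · have hℓ0 : 0 < ℓ := zero_lt_one.trans_le h.one_le
      -- The preimage of y under the rotation, reduced to [0, ℓ).
      set x := y - ρ - ⌊(y - ρ) / ℓ⌋ * ℓ with hxdef
      have hxℓ : x ∈ Set.Ico 0 ℓ := by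
        have h1 := Int.floor_le ((y - ρ) / ℓ)
        have h2 := Int.lt_floor_add_one ((y - ρ) / ℓ)
        rw [le_div_iff₀ hℓ0] at h1
        rw [div_lt_iff₀ hℓ0] at h2
        exact ⟨by linarith, by linarith⟩
      have hxa : ∀ k : ℤ, x + k * P ∉ Set.Ico a b := by
        intro k hk
        refine hy.2 (-m - ⌊(y - ρ) / ℓ⌋ * n + k) ?_
        convert hk using 1
        rw [hxdef]
        generalize ⌊(y - ρ) / ℓ⌋ = q
        rw [hρ, hℓ]
        push_cast
        ring
      -- The preimage could fall in the inserted arc [1, ℓ), but `cover` says that the orbits of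
      -- that arc hit [a, b), which the orbit of y avoids.
      have hx1 : x < 1 := by
        by_contra! hx1
        obtain ⟨i, j, hij⟩ := h.cover x hx1 hxℓ.2
        refine hxa (i * m + j * n) ?_
        convert hij using 1
        rw [hρ, hℓ]
        push_cast
        ring
      refine ⟨x, ⟨⟨hxℓ.1, hx1⟩, hxa⟩, ?_⟩
      obtain ⟨i, hi⟩ := h.map_off x ⟨hxℓ.1, hx1⟩ (by simpa using hxa 0)
      refine eq_of_mem_Ico_of_eq_add (-⌊(y - ρ) / ℓ⌋ + i) (h.Ico_subset_Ico hy.1)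
        (h.Ico_subset_Ico (map_mem_Ico _ _ _ ⟨hxℓ.1, hx1⟩)) ?_
      rw [hi, hxdef]
      push_cast
      ring

end Period

/-- Points of E avoid all P-translates of both intervals, so E ⊆ F. Conversely F is stable under
translations by multiples of P that stay in [0, 1); on it M and N rotate by ρ and -ρ, so they are
mutually inverse bijections and F is symmetric invariant. -/
theorem main_of_isRotationOff (h : IsRotationOff α x₁ x₂ ρ ℓ a b σ)
    (hE : (symmMaxInvariant α x₁ x₂).Nonempty)
    (hEK : ∀ e ∈ symmMaxInvariant α x₁ x₂, e ∉ Set.Ico a b)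
    (hEK' : ∀ e ∈ symmMaxInvariant α x₁ x₂, e ∉ Set.Ico (1 - b) (1 - a)) :
    (∃ s : Finset (ℝ × ℝ), IsIcoUnion s (maxInvariant α x₁ x₂)) ∧
    symmMaxInvariant α x₁ x₂ =
      maxInvariant α x₁ x₂ ∩ reflect (endpointExchange (maxInvariant α x₁ x₂)) ∧
    ∀ t ∈ symmMaxInvariant α x₁ x₂,
      map α x₁ x₂ (1 - coherentMap α x₁ x₂ (1 - t)) = t ∧
      1 - coherentMap α x₁ x₂ (1 - map α x₁ x₂ t) = t := by
  obtain ⟨⟨hEsub, hEM, -⟩, hEmax⟩ := isGreatest_symmMaxInvariant α x₁ x₂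
  have hE01 : symmMaxInvariant α x₁ x₂ ⊆ Set.Ico 0 1 := fun x hx => (hEsub hx).1
  have hℓ0 : 0 < ℓ := zero_lt_one.trans_le h.one_le
  obtain ⟨P, hP, ⟨i₀, j₀, hPij⟩, ⟨m, hρ⟩, n, hℓ⟩ :
      ∃ P > 0, (∃ i j : ℤ, P = i * ρ + j * ℓ) ∧ (∃ m : ℤ, ρ = m * P) ∧ ∃ n : ℤ, ℓ = n * P := by
    obtain ⟨e, he⟩ := hE
    exact exists_common_divisor hℓ0 h.lt
      fun i j => h.add_notMem hE01 hEK hEM h.Ico_subset_unit hEK he i j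
  have hEP : ∀ T ⊆ Set.Ico (0 : ℝ) 1, (∀ e ∈ symmMaxInvariant α x₁ x₂, e ∉ T) →
      ∀ e ∈ symmMaxInvariant α x₁ x₂, ∀ k : ℤ, e + k * P ∉ T := by
    intro T hT hET e he k
    have := h.add_notMem hE01 hEK hEM hT hET he (k * i₀) (k * j₀)
    convert this using 2
    nth_rw 1 [hPij]
    push_cast
    ring
  have hEKP := hEP _ h.Ico_subset_unit hEK
  have hEKP' := hEP (Set.Ico (1 - b) (1 - a))
    (Set.Ico_subset_Ico (by linarith [h.le_one]) (by linarith [h.nonneg])) hEK'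
  have hS : maxInvariant α x₁ x₂ = periodicCompl P a b := by
    obtain ⟨e, he⟩ := hE
    exact h.maxInvariant_eq hP hρ hℓ ⟨i₀, j₀, hPij⟩ (hEKP e he)
  rw [hS]
  set F := periodicCompl P a b ∩ reflect (endpointExchange (periodicCompl P a b)) with hF
  have memF : ∀ x, x ∈ F ↔ x ∈ Set.Ico (0 : ℝ) 1 ∧ (∀ k : ℤ, x + k * P ∉ Set.Ico a b) ∧
      ∀ k : ℤ, x + k * P ∉ Set.Ico (1 - b) (1 - a) := by
    intro x
    rw [hF, Set.mem_inter_iff, mem_reflect, mem_endpointExchange_periodicCompl hP]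
    constructor
    · rintro ⟨⟨hx, hx1⟩, -, hx2⟩
      exact ⟨hx, hx1, fun k hk => hx2 (-k) ⟨by push_cast; linarith [hk.2],
        by push_cast; linarith [hk.1]⟩⟩
    · rintro ⟨hx, hx1, hx2⟩
      exact ⟨⟨hx, hx1⟩, ⟨by linarith [hx.2], by linarith [hx.1]⟩,
        fun k hk => hx2 (-k) ⟨by push_cast; linarith [hk.2], by push_cast; linarith [hk.1]⟩⟩
  have transF : ∀ x ∈ F, ∀ y ∈ Set.Ico (0 : ℝ) 1, ∀ i : ℤ, y = x + i * P → y ∈ F := by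
    rintro x hx y hy i rfl
    obtain ⟨-, h1, h2⟩ := (memF x).1 hx
    refine (memF _).2 ⟨hy, fun k => ?_, fun k => ?_⟩
    · simpa [add_mul, add_assoc] using h1 (i + k)
    · simpa [add_mul, add_assoc] using h2 (i + k)
  have hM : ∀ x ∈ F, map α x₁ x₂ x ∈ F ∧ ∃ k : ℤ, map α x₁ x₂ x = x + ρ + k * ℓ := by
    intro x hx
    obtain ⟨hx0, h1, -⟩ := (memF x).1 hx
    obtain ⟨k, hk⟩ := h.map_off x hx0 (by simpa using h1 0)
    exact ⟨transF x hx _ (map_mem_Ico _ _ _ hx0) (m + k * n)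
      (by rw [hk, hρ, hℓ]; push_cast; ring), k, hk⟩
  have hM' : ∀ x ∈ F, 1 - coherentMap α x₁ x₂ (1 - x) ∈ F ∧
      ∃ k : ℤ, 1 - coherentMap α x₁ x₂ (1 - x) = x - ρ + k * ℓ := by
    intro x hx
    obtain ⟨hx0, -, h2⟩ := (memF x).1 hx
    obtain ⟨k, hk⟩ := h.coherentMap_off (1 - x) ⟨by linarith [hx0.2], by linarith [hx0.1]⟩
      (fun hK => h2 0 (by simp only [Int.cast_zero, zero_mul, add_zero]
                          exact ⟨by linarith [hK.2], by linarith [hK.1]⟩))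
    exact ⟨transF x hx _ (one_sub_coherentMap_mem_Ico _ _ _ hx0) (-m - k * n)
      (by rw [hk, hρ, hℓ]; push_cast; ring), -k, by rw [hk]; push_cast; ring⟩
  have h01 : ∀ x ∈ F, x ∈ Set.Ico 0 ℓ := fun x hx => h.Ico_subset_Ico ((memF x).1 hx).1
  have hMM' : ∀ x ∈ F, map α x₁ x₂ (1 - coherentMap α x₁ x₂ (1 - x)) = x := by
    intro x hx
    obtain ⟨h1, k, hk⟩ := hM' x hx
    obtain ⟨h2, i, hi⟩ := hM _ h1
    exact eq_of_mem_Ico_of_eq_add (k + i) (h01 x hx) (h01 _ h2)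
      (by rw [hi, hk]; push_cast; ring)
  have hM'M : ∀ x ∈ F, 1 - coherentMap α x₁ x₂ (1 - map α x₁ x₂ x) = x := by
    intro x hx
    obtain ⟨h1, k, hk⟩ := hM x hx
    obtain ⟨h2, i, hi⟩ := hM' _ h1
    exact eq_of_mem_Ico_of_eq_add (k + i) (h01 x hx) (h01 _ h2)
      (by rw [hi, hk]; push_cast; ring)
  have hEF : symmMaxInvariant α x₁ x₂ = F := by
    refine Set.Subset.antisymm
      (fun e he => (memF e).2 ⟨hE01 he, hEKP e he, hEKP' e he⟩) (hEmax ⟨?_, ?_, ?_⟩)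
    · intro x hx
      obtain ⟨hx0, h1, h2⟩ := (memF x).1 hx
      refine ⟨hx0, ?_⟩
      rintro (hH | hH)
      · exact h1 0 (by simpa using h.Ico_subset hH)
      · have := h.Ioc_subset (mem_reflect.1 hH)
        refine h2 0 ?_
        simp only [Int.cast_zero, zero_mul, add_zero]
        exact ⟨by linarith [this.2], by linarith [this.1]⟩
    · refine Set.Subset.antisymm ?_ fun y hy => ⟨_, (hM' y hy).1, hMM' y hy⟩
      rintro _ ⟨x, hx, rfl⟩
      exact (hM x hx).1
    · refine Set.Subset.antisymm ?_ fun y hy => ?_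
      · rintro _ ⟨y, hy, rfl⟩
        rw [mem_reflect] at hy ⊢
        simpa using (hM' _ hy).1
      · rw [mem_reflect] at hy
        refine ⟨1 - map α x₁ x₂ (1 - y), mem_reflect.2 (by simpa using (hM _ hy).1), ?_⟩
        linarith [hM'M _ hy]
  exact ⟨exists_isIcoUnion_periodicCompl hP, hEF,
    fun t ht => ⟨hMM' t (hEF ▸ ht), hM'M t (hEF ▸ ht)⟩⟩

end IsRotationOff
end PiecewiseLinear

/-! ### How M and its coherent map move the symmetric invariant set. -/

namespace PiecewiseLinear

variable {α x₁ x₂ : ℝ}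

theorem map_of_lt {t : ℝ} (h : t < x₁) :
    ∃ k : ℤ, map α x₁ x₂ t = t + (α + x₂ - x₁) + k := by
  obtain ⟨k, hk⟩ := fract_eq_add_int (t + α + x₂ - x₁)
  exact ⟨k, by rw [map, if_pos h, hk]; ring⟩

theorem map_of_le (h₁₂ : x₁ < x₂) {t : ℝ} (h : x₂ ≤ t) :
    ∃ k : ℤ, map α x₁ x₂ t = t + α + k := by
  obtain ⟨k, hk⟩ := fract_eq_add_int (t + α)
  exact ⟨k, by rw [map, if_neg (by linarith), if_neg (by linarith), hk]⟩

theorem coherentMap_of_le {t : ℝ} (h : t ≤ x₁) :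
    ∃ k : ℤ, coherentMap α x₁ x₂ t = t + (α + x₂ - x₁) + k := by
  obtain ⟨k, hk⟩ := fractStar_eq_add_int (t + α + x₂ - x₁)
  exact ⟨k, by rw [coherentMap, if_pos h, hk]; ring⟩

theorem coherentMap_of_lt (h₁₂ : x₁ < x₂) {t : ℝ} (h : x₂ < t) :
    ∃ k : ℤ, coherentMap α x₁ x₂ t = t + α + k := by
  obtain ⟨k, hk⟩ := fractStar_eq_add_int (t + α)
  exact ⟨k, by rw [coherentMap, if_neg (by linarith), if_neg (by linarith), hk]⟩

theorem eq_of_mem_unit_Ico {x y : ℝ} (k : ℤ) (hx : x ∈ Set.Ico (0 : ℝ) 1)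
    (hy : y ∈ Set.Ico (0 : ℝ) 1) (h : y = x + k) : y = x :=
  eq_of_mem_Ico_of_eq_add k hx hy (by simpa using h)

theorem map_mem_symmMaxInvariant {t : ℝ} (ht : t ∈ symmMaxInvariant α x₁ x₂) :
    map α x₁ x₂ t ∈ symmMaxInvariant α x₁ x₂ := by
  obtain ⟨⟨-, h, -⟩, -⟩ := isGreatest_symmMaxInvariant α x₁ x₂
  exact h ▸ Set.mem_image_of_mem _ ht

theorem one_sub_coherentMap_mem_symmMaxInvariant {t : ℝ} (ht : t ∈ symmMaxInvariant α x₁ x₂) :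
    1 - coherentMap α x₁ x₂ (1 - t) ∈ symmMaxInvariant α x₁ x₂ := by
  obtain ⟨⟨-, -, h⟩, -⟩ := isGreatest_symmMaxInvariant α x₁ x₂
  rw [← mem_reflect, ← h]
  exact Set.mem_image_of_mem _ (mem_reflect.2 (by simpa using ht))

theorem exists_one_sub_coherentMap_eq {t : ℝ} (ht : t ∈ symmMaxInvariant α x₁ x₂) :
    ∃ s ∈ symmMaxInvariant α x₁ x₂, 1 - coherentMap α x₁ x₂ (1 - s) = t := by
  obtain ⟨⟨-, -, h⟩, -⟩ := isGreatest_symmMaxInvariant α x₁ x₂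
  have : 1 - t ∈ reflect (symmMaxInvariant α x₁ x₂) := mem_reflect.2 (by simpa using ht)
  rw [← h] at this
  obtain ⟨s, hs, hst⟩ := this
  exact ⟨1 - s, mem_reflect.1 hs, by rw [sub_sub_cancel, hst]; ring⟩

theorem symmMaxInvariant_subset_Ico : symmMaxInvariant α x₁ x₂ ⊆ Set.Ico 0 1 := fun _ ht =>
  ((isGreatest_symmMaxInvariant α x₁ x₂).1.1 ht).1

theorem lt_or_le_of_mem_symmMaxInvariant {t : ℝ} (ht : t ∈ symmMaxInvariant α x₁ x₂) :
    t < x₁ ∨ x₂ ≤ t := by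
  have := ((isGreatest_symmMaxInvariant α x₁ x₂).1.1 ht).2
  by_contra! h
  exact this (Or.inl h)

theorem lt_or_le_reflect_of_mem_symmMaxInvariant {t : ℝ} (ht : t ∈ symmMaxInvariant α x₁ x₂) :
    t < 1 - x₂ ∨ 1 - x₁ ≤ t := by
  have := ((isGreatest_symmMaxInvariant α x₁ x₂).1.1 ht).2
  by_contra! h
  exact this (Or.inr (mem_reflect.2 ⟨by linarith, by linarith⟩))

theorem not_forall_add_nat_mul_le {t δ c : ℝ} (hδ : 0 < δ)
    (h : ∀ n : ℕ, t + n * δ ≤ c) : False := by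
  obtain ⟨n, hn⟩ := exists_nat_gt ((c - t) / δ)
  rw [div_lt_iff₀ hδ] at hn
  linarith [h n]

/-- On the symmetric maximal invariant set, a point below `1 - H̃` comes from above `H`. -/
theorem le_one_sub_coherentMap (hx₁ : 0 ≤ x₁) (hx₁₂ : x₁ < x₂) (hx₂ : x₂ ≤ 1) {t : ℝ}
    (ht : t ∈ symmMaxInvariant α x₁ x₂) (htx : t < 1 - x₂) :
    x₂ ≤ 1 - coherentMap α x₁ x₂ (1 - t) := by
  by_contra! hlt
  replace hlt : 1 - coherentMap α x₁ x₂ (1 - t) < x₁ :=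
    (lt_or_le_of_mem_symmMaxInvariant (one_sub_coherentMap_mem_symmMaxInvariant ht)).resolve_right
      (not_le.2 hlt)
  -- If N(u) lies below H, then M(N(u)) = u + δ and N(u + δ) = N(u) + δ. A shift by δ cannot jump
  -- over H or 1 - H̃, both of length δ, so the situation reproduces itself.
  have step : ∀ u ∈ symmMaxInvariant α x₁ x₂, u < 1 - x₂ →
      1 - coherentMap α x₁ x₂ (1 - u) < x₁ →
      u + (x₂ - x₁) ∈ symmMaxInvariant α x₁ x₂ ∧ u + (x₂ - x₁) < 1 - x₂ ∧
        1 - coherentMap α x₁ x₂ (1 - (u + (x₂ - x₁))) < x₁ := by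
    intro u hu hux hul
    have hu' := one_sub_coherentMap_mem_symmMaxInvariant hu
    have hu0 := symmMaxInvariant_subset_Ico hu
    have hu0' := symmMaxInvariant_subset_Ico hu'
    obtain ⟨i, hi⟩ := coherentMap_of_lt (α := α) hx₁₂ (show x₂ < 1 - u by linarith)
    obtain ⟨j, hj⟩ := map_of_lt (α := α) (x₂ := x₂) hul
    have h1 : map α x₁ x₂ (1 - coherentMap α x₁ x₂ (1 - u)) = u + (x₂ - x₁) :=
      eq_of_mem_unit_Ico (j - i) ⟨by linarith [hu0.1], by linarith⟩
        (map_mem_Ico _ _ _ hu0') (by rw [hj, hi]; push_cast; ring)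
    have h2 : u + (x₂ - x₁) ∈ symmMaxInvariant α x₁ x₂ := h1 ▸ map_mem_symmMaxInvariant hu'
    have h3 : u + (x₂ - x₁) < 1 - x₂ :=
      (lt_or_le_reflect_of_mem_symmMaxInvariant h2).resolve_right (by linarith)
    have h4 := one_sub_coherentMap_mem_symmMaxInvariant h2
    obtain ⟨k, hk⟩ := coherentMap_of_lt (α := α) hx₁₂
      (show x₂ < 1 - (u + (x₂ - x₁)) by linarith)
    have h5 := eq_of_mem_unit_Ico (x := 1 - coherentMap α x₁ x₂ (1 - u) + (x₂ - x₁)) (i - k)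
      ⟨by linarith [hu0'.1], by linarith⟩ (symmMaxInvariant_subset_Ico h4)
      (by rw [hk, hi]; push_cast; ring)
    refine ⟨h2, h3, (lt_or_le_of_mem_symmMaxInvariant h4).resolve_right ?_⟩
    rw [h5]
    linarith
  refine not_forall_add_nat_mul_le (t := t) (c := 1 - x₂) (sub_pos.2 hx₁₂) fun n => ?_
  suffices h : t + n * (x₂ - x₁) ∈ symmMaxInvariant α x₁ x₂ ∧ t + n * (x₂ - x₁) < 1 - x₂ ∧
      1 - coherentMap α x₁ x₂ (1 - (t + n * (x₂ - x₁))) < x₁ from h.2.1.le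
  induction n with
  | zero => simpa using ⟨ht, htx, hlt⟩
  | succ n ih =>
    have := step _ ih.1 ih.2.1 ih.2.2
    rwa [add_assoc, ← add_one_mul, ← Nat.cast_succ] at this

/-- On the symmetric maximal invariant set, a point above `1 - H̃` comes from below `H`. -/
theorem one_sub_coherentMap_lt (hx₁ : 0 ≤ x₁) (hx₁₂ : x₁ < x₂) (hx₂ : x₂ ≤ 1) {t : ℝ}
    (ht : t ∈ symmMaxInvariant α x₁ x₂) (htx : 1 - x₁ ≤ t) :
    1 - coherentMap α x₁ x₂ (1 - t) < x₁ := by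
  by_contra! hlt
  replace hlt : x₂ ≤ 1 - coherentMap α x₁ x₂ (1 - t) :=
    (lt_or_le_of_mem_symmMaxInvariant (one_sub_coherentMap_mem_symmMaxInvariant ht)).resolve_left
      (not_lt.2 hlt)
  -- The mirror argument: here M ∘ N shifts by -δ.
  have step : ∀ u ∈ symmMaxInvariant α x₁ x₂, 1 - x₁ ≤ u →
      x₂ ≤ 1 - coherentMap α x₁ x₂ (1 - u) →
      u - (x₂ - x₁) ∈ symmMaxInvariant α x₁ x₂ ∧ 1 - x₁ ≤ u - (x₂ - x₁) ∧
        x₂ ≤ 1 - coherentMap α x₁ x₂ (1 - (u - (x₂ - x₁))) := by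
    intro u hu hux hul
    have hu' := one_sub_coherentMap_mem_symmMaxInvariant hu
    have hu0 := symmMaxInvariant_subset_Ico hu
    have hu0' := symmMaxInvariant_subset_Ico hu'
    obtain ⟨i, hi⟩ := coherentMap_of_le (α := α) (x₂ := x₂) (show 1 - u ≤ x₁ by linarith)
    obtain ⟨j, hj⟩ := map_of_le (α := α) hx₁₂ hul
    have h1 : map α x₁ x₂ (1 - coherentMap α x₁ x₂ (1 - u)) = u - (x₂ - x₁) :=
      eq_of_mem_unit_Ico (j - i) ⟨by linarith, by linarith [hu0.2]⟩
        (map_mem_Ico _ _ _ hu0') (by rw [hj, hi]; push_cast; ring)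
    have h2 : u - (x₂ - x₁) ∈ symmMaxInvariant α x₁ x₂ := h1 ▸ map_mem_symmMaxInvariant hu'
    have h3 : 1 - x₁ ≤ u - (x₂ - x₁) :=
      (lt_or_le_reflect_of_mem_symmMaxInvariant h2).resolve_left (by linarith)
    have h4 := one_sub_coherentMap_mem_symmMaxInvariant h2
    obtain ⟨k, hk⟩ := coherentMap_of_le (α := α) (x₂ := x₂)
      (show 1 - (u - (x₂ - x₁)) ≤ x₁ by linarith)
    have h5 := eq_of_mem_unit_Ico (x := 1 - coherentMap α x₁ x₂ (1 - u) - (x₂ - x₁)) (i - k)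
      ⟨by linarith, by linarith [hu0'.2]⟩ (symmMaxInvariant_subset_Ico h4)
      (by rw [hk, hi]; push_cast; ring)
    refine ⟨h2, h3, (lt_or_le_of_mem_symmMaxInvariant h4).resolve_left ?_⟩
    rw [h5]
    linarith
  refine not_forall_add_nat_mul_le (t := -t) (c := x₁ - 1) (sub_pos.2 hx₁₂) fun n => ?_
  suffices h : t - n * (x₂ - x₁) ∈ symmMaxInvariant α x₁ x₂ ∧ 1 - x₁ ≤ t - n * (x₂ - x₁) ∧
      x₂ ≤ 1 - coherentMap α x₁ x₂ (1 - (t - n * (x₂ - x₁))) by linarith [h.2.1]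
  induction n with
  | zero => simpa [-tsub_le_iff_right] using ⟨ht, htx, hlt⟩
  | succ n ih =>
    have := step _ ih.1 ih.2.1 ih.2.2
    rwa [sub_sub, ← add_one_mul, ← Nat.cast_succ] at this

/-- Every point of the symmetric maximal invariant set below `H` is sent above `1 - H̃`. -/
theorem le_map_of_lt (hx₁ : 0 ≤ x₁) (hx₁₂ : x₁ < x₂) (hx₂ : x₂ ≤ 1) {e : ℝ}
    (he : e ∈ symmMaxInvariant α x₁ x₂) (hex : e < x₁) : 1 - x₁ ≤ map α x₁ x₂ e := by
  obtain ⟨t, ht, rfl⟩ := exists_one_sub_coherentMap_eq he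
  have htx := (lt_or_le_reflect_of_mem_symmMaxInvariant ht).resolve_left fun h => by
    linarith [le_one_sub_coherentMap hx₁ hx₁₂ hx₂ ht h]
  obtain ⟨i, hi⟩ := coherentMap_of_le (α := α) (x₂ := x₂) (show 1 - t ≤ x₁ by linarith)
  obtain ⟨j, hj⟩ := map_of_lt (α := α) (x₂ := x₂) hex
  rwa [eq_of_mem_unit_Ico (j - i) (symmMaxInvariant_subset_Ico ht)
    (map_mem_Ico _ _ _ (symmMaxInvariant_subset_Ico he)) (by rw [hj, hi]; push_cast; ring)]

/-- Every point of the symmetric maximal invariant set above `H` is sent below `1 - H̃`. -/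
theorem map_lt_of_le (hx₁ : 0 ≤ x₁) (hx₁₂ : x₁ < x₂) (hx₂ : x₂ ≤ 1) {e : ℝ}
    (he : e ∈ symmMaxInvariant α x₁ x₂) (hex : x₂ ≤ e) : map α x₁ x₂ e < 1 - x₂ := by
  obtain ⟨t, ht, rfl⟩ := exists_one_sub_coherentMap_eq he
  have htx := (lt_or_le_reflect_of_mem_symmMaxInvariant ht).resolve_right fun h => by
    linarith [one_sub_coherentMap_lt hx₁ hx₁₂ hx₂ ht h]
  obtain ⟨i, hi⟩ := coherentMap_of_lt (α := α) hx₁₂ (show x₂ < 1 - t by linarith)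
  obtain ⟨j, hj⟩ := map_of_le (α := α) hx₁₂ hex
  rwa [eq_of_mem_unit_Ico (j - i) (symmMaxInvariant_subset_Ico ht)
    (map_mem_Ico _ _ _ (symmMaxInvariant_subset_Ico he)) (by rw [hj, hi]; push_cast; ring)]

theorem map_eq_of_eq_add {t y : ℝ} (ht : t ∈ Set.Ico (0 : ℝ) 1) (hy : y ∈ Set.Ico (0 : ℝ) 1)
    {s : ℝ} (hs : ∃ k : ℤ, map α x₁ x₂ t = s + k) (k : ℤ) (h : s = y + k) :
    map α x₁ x₂ t = y := by
  obtain ⟨i, hi⟩ := hs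
  exact eq_of_mem_unit_Ico (k + i) hy (map_mem_Ico _ _ _ ht) (by rw [hi, h]; push_cast; ring)

theorem coherentMap_eq_of_eq_add {t y : ℝ} (ht : t ∈ Set.Ioc (0 : ℝ) 1)
    (hy : y ∈ Set.Ioc (0 : ℝ) 1) {s : ℝ} (hs : ∃ k : ℤ, coherentMap α x₁ x₂ t = s + k) (k : ℤ)
    (h : s = y + k) : coherentMap α x₁ x₂ t = y := by
  obtain ⟨i, hi⟩ := hs
  have hm := coherentMap_mem_Ioc α x₁ x₂ ht
  have := eq_of_mem_unit_Ico (x := 1 - y) (y := 1 - coherentMap α x₁ x₂ t) (-k - i)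
    ⟨by linarith [hy.2], by linarith [hy.1]⟩ ⟨by linarith [hm.2], by linarith [hm.1]⟩
    (by rw [hi, h]; push_cast; ring)
  linarith

/-- If the symmetric maximal invariant set has points on both sides of `H`, then on the points
below `H` the translation by `α + x₂ - x₁` does not wrap around, and on the points above `H` the
translation by `α` does. -/
theorem wrap_of_mem_symmMaxInvariant (hα₀ : 0 ≤ α) (hα₁ : α < 1) (hx₁ : 0 ≤ x₁)
    (hx₁₂ : x₁ < x₂) (hx₂ : x₂ ≤ 1) {u v : ℝ} (hu : u ∈ symmMaxInvariant α x₁ x₂) (hux : u < x₁)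
    (hv : v ∈ symmMaxInvariant α x₁ x₂) (hvx : x₂ ≤ v) :
    u + (α + x₂ - x₁) < 1 ∧ 1 ≤ v + α := by
  have hu1 := le_map_of_lt hx₁ hx₁₂ hx₂ hu hux
  have hv1 := map_lt_of_le hx₁ hx₁₂ hx₂ hv hvx
  have hu0 := symmMaxInvariant_subset_Ico hu
  have hv0 := symmMaxInvariant_subset_Ico hv
  -- The unreduced images satisfy u + α + δ < v + α, while M(v) < M(u). Reducing both without
  -- wrapping, or both with one wrap, would preserve the order.
  constructor
  · by_contra! h
    rw [map_eq_of_eq_add (y := u + (α + x₂ - x₁) - 1) hu0 ⟨by linarith, by linarith⟩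
      (map_of_lt hux) 1 (by push_cast; ring)] at hu1
    rw [map_eq_of_eq_add (y := v + α - 1) hv0 ⟨by linarith, by linarith [hv0.2]⟩
      (map_of_le hx₁₂ hvx) 1 (by push_cast; ring)] at hv1
    linarith
  · by_contra! h
    rw [map_eq_of_eq_add (y := u + (α + x₂ - x₁)) hu0 ⟨by linarith [hu0.1], by linarith⟩
      (map_of_lt hux) 0 (by push_cast; ring)] at hu1
    rw [map_eq_of_eq_add (y := v + α) hv0 ⟨by linarith [hv0.1], by linarith⟩
      (map_of_le hx₁₂ hvx) 0 (by push_cast; ring)] at hv1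
    linarith

/-! ### The four rotation models. -/

/-- For E entirely above H: everything below H is absorbed into the excluded interval. -/
theorem isRotationOff_of_below (hx₁ : 0 ≤ x₁) (hx₁₂ : x₁ < x₂) (hx₂ : x₂ ≤ 1) :
    IsRotationOff α x₁ x₂ α 1 0 x₂ (x₂ - x₁) where
  one_le := le_rfl
  shift_ne_zero := by linarith
  nonneg := le_rfl
  le_one := hx₂
  lt := by linarith
  Ico_subset := Set.Ico_subset_Ico_left hx₁
  Ioc_subset := Set.Ioc_subset_Ioc_left hx₁
  map_off x hx hxK := by
    simpa using map_of_le hx₁₂ (not_lt.1 fun h => hxK ⟨hx.1, h⟩)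
  shift_mem x hx hxH := by
    have : x < x₁ := not_le.1 fun h => hxH ⟨h, hx.2⟩
    exact ⟨by linarith [hx.1], by linarith⟩
  map_on x hx hxH := by
    obtain ⟨k, hk⟩ := map_of_lt (α := α) (x₂ := x₂) (not_le.1 fun h => hxH ⟨h, hx.2⟩)
    exact ⟨k, by rw [hk]; ring⟩
  coherentMap_off t ht htK := by
    simpa using coherentMap_of_lt hx₁₂ (not_le.1 fun h => htK ⟨ht.1, h⟩)
  cover x hx hx' := absurd hx' (not_lt.2 hx)

/-- For E entirely below H: everything above H is absorbed. -/
theorem isRotationOff_of_above (hx₁ : 0 ≤ x₁) (hx₁₂ : x₁ < x₂) (hx₂ : x₂ ≤ 1) :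
    IsRotationOff α x₁ x₂ (α + x₂ - x₁) 1 x₁ 1 (-(x₂ - x₁)) where
  one_le := le_rfl
  shift_ne_zero := by linarith
  nonneg := hx₁
  le_one := le_rfl
  lt := by linarith
  Ico_subset := Set.Ico_subset_Ico_right hx₂
  Ioc_subset := Set.Ioc_subset_Ioc_right hx₂
  map_off x hx hxK := by
    simpa using map_of_lt (not_le.1 fun h => hxK ⟨h, hx.2⟩)
  shift_mem x hx hxH := by
    have : x₂ ≤ x := not_lt.1 fun h => hxH ⟨hx.1, h⟩
    exact ⟨by linarith, by linarith [hx.2]⟩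
  map_on x hx hxH := by
    obtain ⟨k, hk⟩ := map_of_le (α := α) hx₁₂ (not_lt.1 fun h => hxH ⟨hx.1, h⟩)
    exact ⟨k, by rw [hk]; ring⟩
  coherentMap_off t ht htK := by
    simpa using coherentMap_of_le (not_lt.1 fun h => htK ⟨h, ht.2⟩)
  cover x hx hx' := absurd hx' (not_lt.2 hx)

/-- For E on both sides with 1 - α < x₂: the points [1 - (α + δ), x₁), which wrap although they lie
below H, are absorbed. On the longer circle, translation by α - 1 is rotation by α + δ minus one
turn. -/
theorem isRotationOff_of_one_lt (hα₁ : α < 1)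
    (hx₁₂ : x₁ < x₂) (hx₂ : x₂ ≤ 1) (hβ : α + x₂ - x₁ ≤ 1) (h : 1 < α + x₂) :
    IsRotationOff α x₁ x₂ (α + x₂ - x₁) (1 + (x₂ - x₁)) (1 - (α + x₂ - x₁)) x₂ (x₂ - x₁) where
  one_le := by linarith
  shift_ne_zero := by linarith
  nonneg := by linarith
  le_one := hx₂
  lt := by linarith
  Ico_subset := Set.Ico_subset_Ico_left (by linarith)
  Ioc_subset := Set.Ioc_subset_Ioc_left (by linarith)
  map_off x hx hxK := by
    rcases lt_or_ge x (1 - (α + x₂ - x₁)) with hlt | hge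
    · refine ⟨0, ?_⟩
      rw [map_eq_of_eq_add (y := x + (α + x₂ - x₁)) hx ⟨by linarith [hx.1], by linarith⟩
        (map_of_lt (by linarith)) 0 (by push_cast; ring)]
      push_cast; ring
    · have hxx : x₂ ≤ x := not_lt.1 fun h => hxK ⟨hge, h⟩
      refine ⟨-1, ?_⟩
      rw [map_eq_of_eq_add (y := x + α - 1) hx ⟨by linarith, by linarith [hx.2]⟩
        (map_of_le hx₁₂ hxx) 1 (by push_cast; ring)]
      push_cast; ring
  shift_mem x hx hxH := by
    have : x < x₁ := not_le.1 fun h => hxH ⟨h, hx.2⟩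
    exact ⟨by linarith [hx.1], by linarith⟩
  map_on x hx hxH := by
    have hxx : x < x₁ := not_le.1 fun h => hxH ⟨h, hx.2⟩
    refine ⟨-1, ?_⟩
    rw [map_eq_of_eq_add (y := x + (α + x₂ - x₁) - 1) ⟨by linarith [hx.1], by linarith⟩
      ⟨by linarith [hx.1], by linarith⟩ (map_of_lt hxx) 1 (by push_cast; ring)]
    push_cast; ring
  coherentMap_off t ht htK := by
    rcases le_or_gt t (1 - (α + x₂ - x₁)) with hle | hgt
    · refine ⟨0, ?_⟩
      rw [coherentMap_eq_of_eq_add (y := t + (α + x₂ - x₁)) ht ⟨by linarith [ht.1], by linarith⟩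
        (coherentMap_of_le (by linarith)) 0 (by push_cast; ring)]
      push_cast; ring
    · have htx : x₂ < t := not_le.1 fun h => htK ⟨hgt, h⟩
      refine ⟨-1, ?_⟩
      rw [coherentMap_eq_of_eq_add (y := t + α - 1) ht ⟨by linarith, by linarith [ht.2]⟩
        (coherentMap_of_lt hx₁₂ htx) 1 (by push_cast; ring)]
      push_cast; ring
  -- One backward rotation takes [1, 1 + δ) to [1 - (α + δ), 1 - α), inside the excluded interval.
  cover x hx hx' := ⟨-1, 0, by push_cast; linarith, by push_cast; linarith⟩

/-- For E on both sides with x₂ ≤ 1 - α: the points [x₂, 1 - α), which lie above H but do not wrap,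
are absorbed. -/
theorem isRotationOff_of_le_one (hα₁ : α < 1) (hα₀ : 0 ≤ α) (hx₁ : 0 ≤ x₁)
    (hx₁₂ : x₁ < x₂) (h : α + x₂ ≤ 1) :
    IsRotationOff α x₁ x₂ (α + x₂ - x₁) (1 + (x₂ - x₁)) x₁ (1 - α) (-(x₂ - x₁)) where
  one_le := by linarith
  shift_ne_zero := by linarith
  nonneg := hx₁
  le_one := by linarith
  lt := by linarith
  Ico_subset := Set.Ico_subset_Ico_right (by linarith)
  Ioc_subset := Set.Ioc_subset_Ioc_right (by linarith)
  map_off x hx hxK := by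
    rcases lt_or_ge x x₁ with hlt | hge
    · refine ⟨0, ?_⟩
      rw [map_eq_of_eq_add (y := x + (α + x₂ - x₁)) hx ⟨by linarith [hx.1], by linarith⟩
        (map_of_lt hlt) 0 (by push_cast; ring)]
      push_cast; ring
    · have hxx : 1 - α ≤ x := not_lt.1 fun h => hxK ⟨hge, h⟩
      refine ⟨-1, ?_⟩
      rw [map_eq_of_eq_add (y := x + α - 1) hx ⟨by linarith, by linarith [hx.2]⟩
        (map_of_le hx₁₂ (by linarith)) 1 (by push_cast; ring)]
      push_cast; ring
  shift_mem x hx hxH := by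
    have : x₂ ≤ x := not_lt.1 fun h => hxH ⟨hx.1, h⟩
    exact ⟨by linarith, by linarith [hx.2]⟩
  map_on x hx hxH := by
    have hxx : x₂ ≤ x := not_lt.1 fun h => hxH ⟨hx.1, h⟩
    refine ⟨0, ?_⟩
    rw [map_eq_of_eq_add (y := x + α) ⟨by linarith [hx.1], by linarith [hx.2]⟩
      ⟨by linarith [hx.1], by linarith [hx.2]⟩ (map_of_le hx₁₂ hxx) 0 (by push_cast; ring)]
    push_cast; ring
  coherentMap_off t ht htK := by
    rcases le_or_gt t x₁ with hle | hgt
    · refine ⟨0, ?_⟩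
      rw [coherentMap_eq_of_eq_add (y := t + (α + x₂ - x₁)) ht ⟨by linarith [ht.1], by linarith⟩
        (coherentMap_of_le hle) 0 (by push_cast; ring)]
      push_cast; ring
    · have htx : 1 - α < t := not_le.1 fun h => htK ⟨hgt, h⟩
      refine ⟨-1, ?_⟩
      rw [coherentMap_eq_of_eq_add (y := t + α - 1) ht ⟨by linarith, by linarith [ht.2]⟩
        (coherentMap_of_lt hx₁₂ (by linarith)) 1 (by push_cast; ring)]
      push_cast; ring
  cover x hx hx' := ⟨-1, 0, by push_cast; linarith, by push_cast; linarith⟩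

end PiecewiseLinear

/-! ### Choice of the model according to the position of E. -/

open PiecewiseLinear in
theorem corollary1p6 (α x₁ x₂ : ℝ) (hα₀ : 0 ≤ α) (hα₁ : α < 1)
    (hx₁ : 0 ≤ x₁) (hx₁₂ : x₁ < x₂) (hx₂ : x₂ ≤ 1)
    (hE : (symmMaxInvariant α x₁ x₂).Nonempty) :
    (∃ s : Finset (ℝ × ℝ), IsIcoUnion s (maxInvariant α x₁ x₂)) ∧
    symmMaxInvariant α x₁ x₂ =
      maxInvariant α x₁ x₂ ∩ reflect (endpointExchange (maxInvariant α x₁ x₂)) ∧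
    ∀ t ∈ symmMaxInvariant α x₁ x₂,
      map α x₁ x₂ (1 - coherentMap α x₁ x₂ (1 - t)) = t ∧
      1 - coherentMap α x₁ x₂ (1 - map α x₁ x₂ t) = t := by
  by_cases hU : ∀ e ∈ symmMaxInvariant α x₁ x₂, x₂ ≤ e
  · refine (isRotationOff_of_below hx₁ hx₁₂ hx₂).main_of_isRotationOff hE
      (fun e he h => by linarith [hU e he, h.2]) fun e he h => ?_
    rcases lt_or_le_reflect_of_mem_symmMaxInvariant he with h' | h'
    · linarith [h.1]
    · linarith [one_sub_coherentMap_lt hx₁ hx₁₂ hx₂ he h',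
        hU _ (one_sub_coherentMap_mem_symmMaxInvariant he)]
  by_cases hV : ∀ e ∈ symmMaxInvariant α x₁ x₂, e < x₁
  · refine (isRotationOff_of_above hx₁ hx₁₂ hx₂).main_of_isRotationOff hE
      (fun e he h => by linarith [hV e he, h.1]) fun e he h => ?_
    rcases lt_or_le_reflect_of_mem_symmMaxInvariant he with h' | h'
    · linarith [le_one_sub_coherentMap hx₁ hx₁₂ hx₂ he h',
        hV _ (one_sub_coherentMap_mem_symmMaxInvariant he)]
    · linarith [h.2]
  push Not at hU hV
  obtain ⟨u, hu, hux⟩ := hU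
  obtain ⟨v, hv, hvx⟩ := hV
  replace hux := (lt_or_le_of_mem_symmMaxInvariant hu).resolve_right (not_le.2 hux)
  replace hvx := (lt_or_le_of_mem_symmMaxInvariant hv).resolve_left (not_lt.2 hvx)
  have hlow : ∀ e ∈ symmMaxInvariant α x₁ x₂, e < x₁ → e + (α + x₂ - x₁) < 1 := fun e he h =>
    (wrap_of_mem_symmMaxInvariant hα₀ hα₁ hx₁ hx₁₂ hx₂ he h hv hvx).1
  have hhigh : ∀ e ∈ symmMaxInvariant α x₁ x₂, x₂ ≤ e → 1 ≤ e + α := fun e he h =>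
    (wrap_of_mem_symmMaxInvariant hα₀ hα₁ hx₁ hx₁₂ hx₂ hu hux he h).2
  -- Such an e is the unwrapped image N(e) + α + δ of a nonnegative number. This and the next bound
  -- keep E out of the reflected interval [1 - b, 1 - a).
  have hge : ∀ e ∈ symmMaxInvariant α x₁ x₂, 1 - x₁ ≤ e → α + x₂ - x₁ ≤ e := by
    intro e he h
    have h1 := one_sub_coherentMap_lt hx₁ hx₁₂ hx₂ he h
    have h2 := one_sub_coherentMap_mem_symmMaxInvariant he
    have h3 := symmMaxInvariant_subset_Ico h2
    have h4 := symmMaxInvariant_subset_Ico he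
    have h5 := hlow _ h2 h1
    obtain ⟨k, hk⟩ := coherentMap_of_le (α := α) (x₂ := x₂) (show 1 - e ≤ x₁ by linarith)
    have := eq_of_mem_unit_Ico (x := e)
      (y := 1 - coherentMap α x₁ x₂ (1 - e) + (α + x₂ - x₁)) (-k) h4
      ⟨by linarith [h3.1], h5⟩ (by rw [hk]; push_cast; ring)
    linarith [h3.1]
  -- Here e = N(e) + α - 1 with N(e) < 1.
  have hlt : ∀ e ∈ symmMaxInvariant α x₁ x₂, e < 1 - x₂ → e < α := by
    intro e he h
    have h1 := le_one_sub_coherentMap hx₁ hx₁₂ hx₂ he h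
    have h2 := one_sub_coherentMap_mem_symmMaxInvariant he
    have h3 := symmMaxInvariant_subset_Ico h2
    have h4 := symmMaxInvariant_subset_Ico he
    have h5 := hhigh _ h2 h1
    obtain ⟨k, hk⟩ := coherentMap_of_lt (α := α) hx₁₂ (show x₂ < 1 - e by linarith)
    have := eq_of_mem_unit_Ico (x := e)
      (y := 1 - coherentMap α x₁ x₂ (1 - e) + α - 1) (-k - 1) h4
      ⟨by linarith [h3.1], by linarith [h3.2]⟩ (by rw [hk]; push_cast; ring)
    linarith [h3.2]
  rcases lt_or_ge 1 (α + x₂) with h | h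
  · refine (isRotationOff_of_one_lt hα₁ hx₁₂ hx₂
      (by linarith [hlow u hu hux, (symmMaxInvariant_subset_Ico hu).1]) h).main_of_isRotationOff hE
      (fun e he hK => ?_) fun e he hK => ?_
    · rcases lt_or_le_of_mem_symmMaxInvariant he with h' | h'
      · linarith [hlow e he h', hK.1]
      · linarith [hK.2]
    · rcases lt_or_le_reflect_of_mem_symmMaxInvariant he with h' | h'
      · linarith [hK.1]
      · linarith [hge e he h', hK.2]
  · refine (isRotationOff_of_le_one hα₁ hα₀ hx₁ hx₁₂ h).main_of_isRotationOff hE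
      (fun e he hK => ?_) fun e he hK => ?_
    · rcases lt_or_le_of_mem_symmMaxInvariant he with h' | h'
      · linarith [hK.1]
      · linarith [hhigh e he h', hK.2]
    · rcases lt_or_le_reflect_of_mem_symmMaxInvariant he with h' | h'
      · linarith [hlt e he h', hK.1]
      · linarith [hK.2]
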